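/- A parking function of size $n\ge 1$ is a function $\pi:\{1,\dots,n\}\to\{1,\dots,n\}$ whose nondecreasing rearrangement $\pi'(1)\le\dots\le\pi'(n)$ satisfies $\pi'(i)\le i$ for all $i$. Let $\pi_n$ be chosen uniformly at random among all parking functions of size $n$. For $0\le k\le n$ put $$d_{TV}(k,n)=\sum_{i_1,\dots,i_k=1}^n\left|\mathbb P(\pi_n(1)=i_1,\dots,\pi_n(k)=i_k)-\frac1{n^k}\right|,$$ $$d_K(k,n)=\max_{i_1,\dots,i_k\in\{1,\dots,n\}}\left|\mathbb P(\pi_n(1)\le i_1,\dots,\pi_n(k)\le i_k)-\frac{i_1\cdots i_k}{n^k}\right|,$$ the total variation distance (normalised as an $\ell^1$ distance) and the Kolmogorov distance between $(\pi_n(1),\dots,\pi_n(k))$ and $k$ i.i.d. uniform variables on $\{1,\dots,n\}$. Let $(k_n)_{n\ge1}$ be any sequence of integers with $0\le k_n\le n$. As $n\to\infty$: (i) If $k_n=o(\sqrt n)$, then $d_{TV}(k_n,n)=O\left(\dfrac{k_n}{\sqrt n}\right)$. (ii) If $k_n=o(n)$ and $\sqrt n=o(k_n)$, then $d_K(k_n,n)=O\left(\dfrac{\sqrt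 n}{k_n}+\left(\dfrac{k_n}{n}\right)^{0.19}\right)$. The implied constants may depend on the sequence $(k_n)$. -/

import Mathlib

open Filter Asymptotics

/-- The parking functions of size `n`. Positions and places `1, …, n` are represented by the
elements `0, …, n - 1` of `Fin n`. The function `π ∘ Tuple.sort π` is the nondecreasing
rearrangement of `π`, and the condition `π'(i) ≤ i` is not affected by the shift. -/
def parkingFunctions (n : ℕ) : Set (Fin n → Fin n) :=
  {π | ∀ i : Fin n, (π ∘ Tuple.sort π) i ≤ i}

/-- The law of a uniform parking function of size `n`. -/
noncomputable def parkingLaw (n : ℕ) : MeasureTheory.Measure (Fin n → Fin n) :=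
  ProbabilityTheory.uniformOn (parkingFunctions n)

/-- The total variation distance (normalised as the `ℓ¹` distance of the mass functions) between
the first `k` places of a uniform parking function of size `n` and `k` i.i.d. uniform variables. -/
noncomputable def parkingDTV (k n : ℕ) (hk : k ≤ n) : ℝ :=
  ∑ i : Fin k → Fin n,
    |(parkingLaw n).real {π | ∀ j : Fin k, π (Fin.castLE hk j) = i j} - 1 / (n : ℝ) ^ k|

/-- The Kolmogorov distance between the first `k` places of a uniform parking function of size `n`
and `k` i.i.d. uniform variables. The supremum is over a finite nonempty type, so it is a maximum;
`(i j : ℝ) + 1` is the place in `{1, …, n}` represented by `i j`. -/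
noncomputable def parkingDK (k n : ℕ) (hk : k ≤ n) : ℝ :=
  ⨆ i : Fin k → Fin n,
    |(parkingLaw n).real {π | ∀ j : Fin k, π (Fin.castLE hk j) ≤ i j}
      - (∏ j : Fin k, (((i j : ℕ) : ℝ) + 1)) / (n : ℝ) ^ k|

section Parking
open Finset

variable {ι : Type*} [Fintype ι] {N : ℕ}

/-- The parking condition for a preference function with values in an initial segment of `ℕ`:
for every `s < N`, at least `s` cars prefer one of the first `s` places. -/
def IsParking (u : ι → Fin N) : Prop :=
  ∀ s < N, s ≤ #{i | (u i : ℕ) < s}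

instance : DecidablePred (IsParking : (ι → Fin N) → Prop) :=
  fun u => inferInstanceAs (Decidable (∀ s < N, s ≤ #{i | (u i : ℕ) < s}))

theorem card_filter_range_add (f : ι → ℕ) {a b : ℕ} (hab : a ≤ b) :
    #{i | a ≤ f i ∧ f i < b} + #{i | f i < a} = #{i | f i < b} := by
  simp only [card_filter, ← sum_add_distrib]
  refine sum_congr rfl fun i _ => ?_
  split_ifs <;> omega

theorem card_filter_compl_range_add (f : ι → ℕ) {a b : ℕ} (hab : a ≤ b) :
    #{i | ¬ (a ≤ f i ∧ f i < b)} + #{i | f i < b} = #{i | f i < a} + Fintype.card ι := by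
  rw [show Fintype.card ι = ∑ _i : ι, 1 by simp]
  simp only [card_filter, ← sum_add_distrib]
  refine sum_congr rfl fun i _ => ?_
  split_ifs <;> omega

theorem Fin.val_sub_lt_iff_of_add_le {a c : Fin N} {s : ℕ} (h : (c : ℕ) + s ≤ N) :
    ((a - c : Fin N) : ℕ) < s ↔ (c : ℕ) ≤ a ∧ (a : ℕ) < c + s := by
  have ha := a.2
  rcases le_or_gt c a with hca | hca
  · rw [Fin.sub_val_of_le hca]
    have : (c : ℕ) ≤ a := hca
    omega
  · rw [Fin.coe_sub_iff_lt.2 hca]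
    have : (a : ℕ) < c := hca
    omega

theorem Fin.val_sub_lt_iff_of_le_add {a c : Fin N} {s : ℕ} (h : N ≤ (c : ℕ) + s) :
    ((a - c : Fin N) : ℕ) < s ↔ ¬ ((c : ℕ) + s - N ≤ a ∧ (a : ℕ) < c) := by
  have ha := a.2
  rcases le_or_gt c a with hca | hca
  · rw [Fin.sub_val_of_le hca]
    have : (c : ℕ) ≤ a := hca
    omega
  · rw [Fin.coe_sub_iff_lt.2 hca]
    have : (a : ℕ) < c := hca
    omega

theorem IsParking.eq_of_sub {u : ι → Fin N} (hN : Fintype.card ι + 1 = N) {c d : Fin N}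
    (hc : IsParking fun i => u i - c) (hd : IsParking fun i => u i - d) : c = d := by
  by_contra hne
  wlog hlt : c < d generalizing c d
  · exact this hd hc (Ne.symm hne) (lt_of_le_of_ne (not_lt.1 hlt) (Ne.symm hne))
  have hlt' : (c : ℕ) < d := hlt
  have hd2 := d.2
  have h1 := hc (d - c) (by omega)
  have h2 := hd (N - (d - c)) (by omega)
  simp only [Fin.val_sub_lt_iff_of_add_le (show (c : ℕ) + (d - c) ≤ N by omega)] at h1
  simp only [Fin.val_sub_lt_iff_of_le_add (show N ≤ (d : ℕ) + (N - (d - c)) by omega)] at h2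
  rw [show (c : ℕ) + (d - c) = d by omega] at h1
  rw [show (d : ℕ) + (N - (d - c)) - N = c by omega] at h2
  have h3 := card_filter_range_add (fun i => (u i : ℕ)) hlt'.le
  have h4 := card_filter_compl_range_add (fun i => (u i : ℕ)) hlt'.le
  omega

theorem exists_isParking_sub (hN : Fintype.card ι + 1 = N) (u : ι → Fin N) :
    ∃ c : Fin N, IsParking fun i => u i - c := by
  set F : ℕ → ℕ := fun t => #{i | (u i : ℕ) < t} with hF
  obtain ⟨c, hc, hmin⟩ := exists_min_image (Icc 1 N)
    (fun t : ℕ => ((N : ℤ) + 1) * ((F t : ℤ) - t) + t) ⟨N, by simp; omega⟩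
  rw [mem_Icc] at hc
  have hle : ∀ t, c ≤ t → t ≤ N → (F c : ℤ) - c ≤ F t - t := by
    intro t h1 h2
    have := hmin t (mem_Icc.2 ⟨by omega, h2⟩)
    by_contra hcon
    have h3 : (F t : ℤ) - t + 1 ≤ F c - c := by omega
    nlinarith
  have hlt : ∀ t, 1 ≤ t → t < c → (F c : ℤ) - c < F t - t := by
    intro t h1 h2
    have := hmin t (mem_Icc.2 ⟨by omega, by omega⟩)
    by_contra hcon
    have h3 : (F t : ℤ) - t ≤ F c - c := by omega
    have h4 : (t : ℤ) < c := by exact_mod_cast h2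
    nlinarith
  have hFN : F N = Fintype.card ι := by simp [hF]
  have hF0 : F 0 = 0 := by simp [hF]
  have hcN := hle N hc.2 le_rfl
  have hlt0 : ∀ t, t < c → (F c : ℤ) - c < F t - t := by
    intro t h2
    rcases Nat.eq_zero_or_pos t with rfl | h1
    · omega
    · exact hlt t h1 h2
  rcases hc.2.eq_or_lt with rfl | hcN'
  · refine ⟨⟨0, by omega⟩, fun s hs => ?_⟩
    simp only [Fin.val_sub_lt_iff_of_add_le (show ((⟨0, by omega⟩ : Fin c) : ℕ) + s ≤ c by
      simp; omega)]
    have := hlt0 s hs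
    simp only [zero_le, true_and, zero_add]
    change s ≤ F s
    omega
  · refine ⟨⟨c, hcN'⟩, fun s hs => ?_⟩
    rcases le_or_gt (c + s) N with h | h
    · simp only [Fin.val_sub_lt_iff_of_add_le (show ((⟨c, hcN'⟩ : Fin N) : ℕ) + s ≤ N from h)]
      have h1 := card_filter_range_add (fun i => (u i : ℕ)) (show c ≤ c + s by omega)
      have h2 := hle (c + s) (by omega) h
      simp only [hF] at h2
      push_cast at h2
      omega
    · simp only [Fin.val_sub_lt_iff_of_le_add (show N ≤ ((⟨c, hcN'⟩ : Fin N) : ℕ) + s from h.le)]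
      have h1 := card_filter_compl_range_add (fun i => (u i : ℕ)) (show c + s - N ≤ c by omega)
      have h2 := hlt0 (c + s - N) (by omega)
      simp only [hF] at h2
      omega

variable [DecidableEq ι]

/-- The cycle lemma: one in `N = #ι + 1` of all functions to `Fin N` is a parking function. -/
theorem card_isParking_mul (hN : Fintype.card ι + 1 = N) :
    #{u : ι → Fin N | IsParking u} * N = N ^ Fintype.card ι := by
  have h1 : ∀ u : ι → Fin N, #{c : Fin N | IsParking fun i => u i - c} = 1 := by
    intro u
    obtain ⟨c, hc⟩ := exists_isParking_sub hN u
    rw [card_eq_one]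
    refine ⟨c, ?_⟩
    ext d
    simp only [mem_filter, mem_univ, true_and, mem_singleton]
    exact ⟨fun hd => hd.eq_of_sub hN hc, fun h => h ▸ hc⟩
  have h2 : ∀ c : Fin N, #{u : ι → Fin N | IsParking fun i => u i - c} =
      #{u : ι → Fin N | IsParking u} := by
    intro c
    have : NeZero N := ⟨by omega⟩
    refine card_bij' (fun u _ i => u i - c) (fun u _ i => u i + c) ?_ ?_ ?_ ?_
    · simp
    · simp
    · intro u _; ext i; simp
    · intro u _; ext i; simp
  calc #{u : ι → Fin N | IsParking u} * N
      = ∑ c : Fin N, #{u : ι → Fin N | IsParking fun i => u i - c} := by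
        simp [h2, mul_comm]
    _ = ∑ u : ι → Fin N, #{c : Fin N | IsParking fun i => u i - c} := by
        simp only [card_filter]; exact sum_comm
    _ = N ^ Fintype.card ι := by simp [h1]

/-- The number of values at `j` that turn `u` into a parking function. -/
def reach (j : ι) (u : ι → Fin N) : ℕ :=
  #{x : Fin N | IsParking (Function.update u j x)}

theorem IsParking.update_of_le {u : ι → Fin N} {j : ι} {x y : Fin N} (hyx : y ≤ x)
    (h : IsParking (Function.update u j x)) : IsParking (Function.update u j y) := by
  intro s hs
  refine (h s hs).trans (card_le_card fun i => ?_)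
  simp only [mem_filter, mem_univ, true_and]
  have : (y : ℕ) ≤ x := hyx
  rcases eq_or_ne i j with rfl | hij
  · simp; omega
  · simp [hij]

theorem isParking_update_iff {u : ι → Fin N} {j : ι} {x : Fin N} :
    IsParking (Function.update u j x) ↔ (x : ℕ) < reach j u := by
  constructor
  · intro h
    have : #(Iic x) ≤ reach j u := card_le_card fun y hy => by
      simp only [mem_filter, mem_univ, true_and]
      exact h.update_of_le (mem_Iic.1 hy)
    rw [Fin.card_Iic] at this
    omega
  · intro h
    by_contra hx
    have : reach j u ≤ #(Iio x) := card_le_card fun y hy => by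
      simp only [mem_filter, mem_univ, true_and] at hy
      rw [mem_Iio]
      by_contra hyx
      exact hx (hy.update_of_le (not_lt.1 hyx))
    rw [Fin.card_Iio] at this
    omega

theorem reach_le (j : ι) (u : ι → Fin N) : reach j u ≤ N :=
  (card_le_univ _).trans (by simp)

end Parking

section ReachFiber
open Finset

theorem card_subtype_filter {ι : Type*} (S : Finset ι) (P : ι → Prop) [DecidablePred P] :
    #{i : S | P i} = #{i ∈ S | P i} := by
  rw [← card_map (Function.Embedding.subtype _)]
  congr 1
  ext i
  simp [and_comm]

variable {ι : Type*} [Fintype ι] [DecidableEq ι] {N : ℕ}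

/-- Glue two functions on disjoint sets of indices, the second one shifted up by `p`, and give the
remaining indices the value `x`. -/
def glue {p q : ℕ} (hpq : p + q = N) (S T : Finset ι)
    (w : ((S → Fin p) × (T → Fin q)) × Fin N) (i : ι) : Fin N :=
  if hS : i ∈ S then ⟨w.1.1 ⟨i, hS⟩, by omega⟩
  else if hT : i ∈ T then ⟨p + w.1.2 ⟨i, hT⟩, by omega⟩
  else w.2

theorem card_filter_update {u : ι → Fin N} {j : ι} {x : Fin N} (s : ℕ) :
    #{i | (Function.update u j x i : ℕ) < s} =
      #{i ∈ univ.erase j | (u i : ℕ) < s} + if (x : ℕ) < s then 1 else 0 := by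
  simp only [card_filter]
  rw [← add_sum_erase univ _ (mem_univ j), add_comm]
  simp only [Function.update_self]
  congr 1
  refine sum_congr rfl fun i hi => ?_
  rw [Function.update_of_ne (ne_of_mem_erase hi)]

/-- If the reach of `u` at `j` is `p`, the other values split into a parking function below `p`
and a parking function above `p`. -/
theorem exists_glue_of_reach_eq (hN : Fintype.card ι + 1 = N) {p q : ℕ} (hp : 1 ≤ p) (hq : 1 ≤ q)
    (hpq : p + q = N) {j : ι} {u : ι → Fin N} (hu : reach j u = p) :
    ∃ S ∈ powersetCard (p - 1) (univ.erase j),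
      ∃ w ∈ (({a : S → Fin p | IsParking a} : Finset _) ×ˢ
        ({b : (univ.erase j \ S : Finset ι) → Fin q | IsParking b} : Finset _)) ×ˢ
        (univ : Finset (Fin N)), glue hpq S _ w = u := by
  have h1 : IsParking (Function.update u j ⟨p - 1, by omega⟩) :=
    isParking_update_iff.2 (by simp; omega)
  have h2 : ¬ IsParking (Function.update u j ⟨p, by omega⟩) := fun h => by
    have := isParking_update_iff.1 h
    simp [hu] at this
  set F : ℕ → ℕ := fun s => #{i ∈ univ.erase j | (u i : ℕ) < s} with hF
  have h1' : ∀ s < N, s ≤ F s + if p - 1 < s then 1 else 0 := fun s hs => by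
    have := h1 s hs
    rwa [card_filter_update] at this
  have h2' : ∃ s < N, F s + (if p < s then 1 else 0) < s := by
    simp only [IsParking, not_forall, not_le] at h2
    obtain ⟨s, hs, h⟩ := h2
    rw [card_filter_update] at h
    exact ⟨s, hs, h⟩
  have hFp : F p = p - 1 := by
    obtain ⟨s, hs, h⟩ := h2'
    have h3 := h1' s hs
    have : s = p := by
      split_ifs at h h3 <;> omega
    subst this
    split_ifs at h h3 <;> omega
  have hcard : #(univ.erase j) = N - 2 := by
    rw [card_erase_of_mem (mem_univ j), card_univ]; omega
  set S : Finset ι := {i ∈ univ.erase j | (u i : ℕ) < p} with hS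
  have hSsub : S ⊆ univ.erase j := filter_subset _ _
  have hSc : #S = p - 1 := hFp
  have hTc : #(univ.erase j \ S) = q - 1 := by
    rw [card_sdiff_of_subset hSsub, hcard, hSc]; omega
  have hlt : ∀ i ∈ S, (u i : ℕ) < p := fun i hi => (mem_filter.1 hi).2
  have hge : ∀ i ∈ univ.erase j \ S, p ≤ (u i : ℕ) := fun i hi => by
    rw [Finset.mem_sdiff, hS, mem_filter, not_and] at hi
    exact not_lt.1 (hi.2 hi.1)
  refine ⟨S, mem_powersetCard.2 ⟨hSsub, hSc⟩,
    ((fun i => ⟨u i, hlt i i.2⟩, fun i => ⟨u i - p, by have := (u i).2; have := hge i i.2; omega⟩),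
      u j), ?_, ?_⟩
  · simp only [mem_product, mem_filter, mem_univ, true_and, and_true]
    constructor
    · intro s hs
      have h3 := h1' s (by omega)
      rw [if_neg (by omega)] at h3
      simp only
      rw [card_subtype_filter S (fun i => (u i : ℕ) < s)]
      refine h3.trans (card_le_card fun i hi => ?_)
      simp only [hS, mem_filter] at hi ⊢
      exact ⟨⟨hi.1, by omega⟩, hi.2⟩
    · intro s hs
      have h3 := h1' (p + s) (by omega)
      rw [if_pos (by omega)] at h3
      simp only
      rw [card_subtype_filter (univ.erase j \ S) (fun i => (u i : ℕ) - p < s)]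
      have h4 : F (p + s) ≤ #S + #{i ∈ univ.erase j \ S | (u i : ℕ) - p < s} := by
        refine le_trans (card_le_card fun i hi => ?_) (card_union_le _ _)
        simp only [hS, mem_union, mem_filter, Finset.mem_sdiff] at hi ⊢
        by_cases hip : (u i : ℕ) < p
        · exact Or.inl ⟨hi.1, hip⟩
        · exact Or.inr ⟨⟨hi.1, fun h => hip h.2⟩, by omega⟩
      omega
  · funext i
    unfold glue
    split_ifs with hi hi'
    · rfl
    · ext
      have := hge i hi'
      simp only
      omega
    · have : i = j := by
        by_contra hij
        exact hi' (Finset.mem_sdiff.2 ⟨mem_erase.2 ⟨hij, mem_univ i⟩, hi⟩)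
      rw [this]

theorem card_isParking_mul_sq {N : ℕ} (hN : Fintype.card ι + 1 = N) :
    #{u : ι → Fin N | IsParking u} * N ^ 2 = N ^ N := by
  rw [pow_two, ← mul_assoc, card_isParking_mul hN, ← pow_succ, hN]

theorem card_reach_eq_le (hN : Fintype.card ι + 1 = N) {p q : ℕ} (hp : 1 ≤ p) (hq : 1 ≤ q)
    (hpq : p + q = N) (j : ι) :
    #{u : ι → Fin N | reach j u = p} * (p ^ 2 * q ^ 2) ≤
      N * (N - 2).choose (p - 1) * (p ^ p * q ^ q) := by
  have hcard : #(univ.erase j) = N - 2 := by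
    rw [card_erase_of_mem (mem_univ j), card_univ]; omega
  let W : (S : Finset ι) →
      Finset (((S → Fin p) × ((univ.erase j \ S : Finset ι) → Fin q)) × Fin N) := fun S =>
    (({a : S → Fin p | IsParking a} : Finset _) ×ˢ
        ({b : (univ.erase j \ S : Finset ι) → Fin q | IsParking b} : Finset _)) ×ˢ univ
  have hsub : ({u : ι → Fin N | reach j u = p} : Finset _) ⊆
      (powersetCard (p - 1) (univ.erase j)).biUnion fun S => (W S).image (glue hpq S _) := by
    intro u hu
    obtain ⟨S, hS, w, hw, h⟩ := exists_glue_of_reach_eq hN hp hq hpq (mem_filter.1 hu).2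
    exact mem_biUnion.2 ⟨S, hS, mem_image.2 ⟨w, hw, h⟩⟩
  have hW : ∀ S ∈ powersetCard (p - 1) (univ.erase j),
      #(W S) * (p ^ 2 * q ^ 2) = N * (p ^ p * q ^ q) := by
    intro S hS
    rw [mem_powersetCard] at hS
    have h1 : Fintype.card S + 1 = p := by rw [Fintype.card_coe]; omega
    have h2 : Fintype.card (univ.erase j \ S : Finset ι) + 1 = q := by
      rw [Fintype.card_coe, card_sdiff_of_subset hS.1, hcard]; omega
    rw [← card_isParking_mul_sq h1, ← card_isParking_mul_sq h2]
    simp only [W, card_product, card_univ, Fintype.card_fin]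
    ring
  calc #{u : ι → Fin N | reach j u = p} * (p ^ 2 * q ^ 2)
      ≤ (∑ S ∈ powersetCard (p - 1) (univ.erase j), #(W S)) * (p ^ 2 * q ^ 2) := by
        gcongr
        exact (card_le_card hsub).trans
          (card_biUnion_le.trans (sum_le_sum fun S _ => card_image_le))
    _ = N * (N - 2).choose (p - 1) * (p ^ p * q ^ q) := by
        rw [sum_mul, sum_congr rfl hW, sum_const, card_powersetCard, hcard, smul_eq_mul]
        ring

end ReachFiber

section Estimates
open Finset Real

theorem factorial_le_stirling {n : ℕ} (hn : n ≠ 0) :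
    (n.factorial : ℝ) ≤ exp 1 * √n * (n / exp 1) ^ n := by
  obtain ⟨k, rfl⟩ := Nat.exists_eq_succ_of_ne_zero hn
  have h : Stirling.stirlingSeq (k + 1) ≤ Stirling.stirlingSeq 1 :=
    Stirling.stirlingSeq'_antitone (Nat.zero_le k)
  rw [Stirling.stirlingSeq_one, Stirling.stirlingSeq, div_le_iff₀ (by positivity)] at h
  refine h.trans_eq ?_
  rw [Real.sqrt_mul (by norm_num)]
  have : √(2 : ℝ) ≠ 0 := by positivity
  field_simp

theorem choose_mul_pow_mul_pow_le {p q : ℕ} (hp : 1 ≤ p) (hq : 1 ≤ q) :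
    ((p + q).choose p : ℝ) * ((p : ℝ) ^ p * (q : ℝ) ^ q) * √(p * q) ≤
      ((p + q : ℕ) : ℝ) ^ (p + q) * √((p + q : ℕ) : ℝ) := by
  have hp' : (0 : ℝ) < p := by exact_mod_cast hp
  have hq' : (0 : ℝ) < q := by exact_mod_cast hq
  have h1 := Stirling.le_factorial_stirling p
  have h2 := Stirling.le_factorial_stirling q
  have h3 := factorial_le_stirling (n := p + q) (by omega)
  have h4 : ((p + q).choose p : ℝ) * p.factorial * q.factorial = (p + q).factorial := by
    rw [Nat.choose_symm_add]
    exact_mod_cast Nat.add_choose_mul_factorial_mul_factorial p q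
  have h5 : (2 * π) * √(p * q) * ((p / exp 1) ^ p * (q / exp 1) ^ q) ≤
      (p.factorial : ℝ) * q.factorial := by
    refine le_trans (le_of_eq ?_) (mul_le_mul h1 h2 (by positivity) (by positivity))
    have : √(2 * π * p) * √(2 * π * q) = 2 * π * √(p * q) := by
      rw [← Real.sqrt_mul (by positivity),
        show 2 * π * p * (2 * π * q) = (2 * π) ^ 2 * (p * q) by ring,
        Real.sqrt_mul (by positivity), Real.sqrt_sq (by positivity)]
    rw [← this]; ring
  have h6 : ((p + q).choose p : ℝ) *
      ((2 * π) * √(p * q) * ((p / exp 1) ^ p * (q / exp 1) ^ q)) ≤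
      exp 1 * √((p + q : ℕ) : ℝ) * (((p + q : ℕ) : ℝ) / exp 1) ^ (p + q) := by
    refine le_trans ?_ h3
    rw [← h4, mul_assoc _ (p.factorial : ℝ)]
    gcongr
  have h7 : (p / exp 1 : ℝ) ^ p * (q / exp 1) ^ q =
      (p : ℝ) ^ p * (q : ℝ) ^ q / exp 1 ^ (p + q) := by
    rw [div_pow, div_pow, pow_add]; field_simp
  have he : exp 1 ≤ 2 * π := by
    have := Real.exp_one_lt_d9
    have := Real.pi_gt_three
    linarith
  have hE : (0 : ℝ) < exp 1 ^ (p + q) := by positivity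
  have h8 : exp 1 * (((p + q).choose p : ℝ) * ((p : ℝ) ^ p * (q : ℝ) ^ q) * √(p * q)) ≤
      exp 1 * (((p + q : ℕ) : ℝ) ^ (p + q) * √((p + q : ℕ) : ℝ)) := by
    rw [h7, div_pow] at h6
    have h9 := mul_le_mul_of_nonneg_right h6 hE.le
    have h10 : exp 1 * √((p + q : ℕ) : ℝ) * (((p + q : ℕ) : ℝ) ^ (p + q) / exp 1 ^ (p + q)) *
        exp 1 ^ (p + q) = exp 1 * (((p + q : ℕ) : ℝ) ^ (p + q) * √((p + q : ℕ) : ℝ)) := by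
      field_simp
    rw [h10] at h9
    refine le_trans ?_ h9
    have h11 : ((p + q).choose p : ℝ) * (2 * π * √(p * q) *
        ((p : ℝ) ^ p * (q : ℝ) ^ q / exp 1 ^ (p + q))) * exp 1 ^ (p + q) =
        2 * π * (((p + q).choose p : ℝ) * ((p : ℝ) ^ p * (q : ℝ) ^ q) * √(p * q)) := by
      field_simp
    rw [h11]
    gcongr
  exact le_of_mul_le_mul_left h8 (exp_pos 1)

theorem sum_one_div_sqrt_le (n : ℕ) : ∑ m ∈ range n, 1 / √((m : ℝ) + 1) ≤ 2 * √n := by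
  induction n with
  | zero => simp
  | succ n ih =>
    rw [sum_range_succ]
    have h0 : (0 : ℝ) ≤ n := by positivity
    have ha : √(n : ℝ) ^ 2 = n := Real.sq_sqrt h0
    have hb : √((n : ℝ) + 1) ^ 2 = n + 1 := Real.sq_sqrt (by positivity)
    have hb0 : 0 < √((n : ℝ) + 1) := by positivity
    push_cast
    have : 1 / √((n : ℝ) + 1) ≤ 2 * (√((n : ℝ) + 1) - √n) := by
      rw [div_le_iff₀ hb0]
      nlinarith [sq_nonneg (√((n : ℝ) + 1) - √n)]
    linarith

/-- The sum of `min b m / m ^ (3 / 2)` over `m ≥ 1` is of order `√b`. -/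
theorem sum_min_div_le (b n : ℕ) :
    ∑ m ∈ range n, min (b : ℝ) (m + 1) / ((m + 1) * √((m : ℝ) + 1)) ≤ 4 * √b := by
  have key : ∀ n, b ≤ n → ∑ m ∈ range n, min (b : ℝ) (m + 1) / ((m + 1) * √((m : ℝ) + 1)) ≤
      4 * √b - 2 * b / √n := by
    intro n hn
    induction n, hn using Nat.le_induction with
    | base =>
      have : 2 * (b : ℝ) / √b = 2 * √b := by
        rw [mul_div_assoc, Real.div_sqrt]
      rw [this]
      have h := sum_one_div_sqrt_le b
      have h2 : ∑ m ∈ range b, min (b : ℝ) (m + 1) / ((m + 1) * √((m : ℝ) + 1)) ≤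
          ∑ m ∈ range b, 1 / √((m : ℝ) + 1) := by
        refine sum_le_sum fun m _ => ?_
        rw [div_le_div_iff₀ (by positivity) (by positivity), one_mul]
        gcongr
        exact min_le_right _ _
      linarith
    | succ n hn ih =>
      rw [sum_range_succ]
      push_cast
      have h1 : min (b : ℝ) (n + 1) / ((n + 1) * √((n : ℝ) + 1)) ≤
          2 * b / √n - 2 * b / √((n : ℝ) + 1) := by
        rcases Nat.eq_zero_or_pos b with rfl | hb
        · have : min (0 : ℝ) (n + 1) = 0 := min_eq_left (by positivity)
          simp [this]
        have hn0 : (0 : ℝ) < n := by exact_mod_cast lt_of_lt_of_le hb hn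
        have ha : √(n : ℝ) ^ 2 = n := Real.sq_sqrt hn0.le
        have hc : √((n : ℝ) + 1) ^ 2 = n + 1 := Real.sq_sqrt (by positivity)
        have ha0 : 0 < √(n : ℝ) := by positivity
        have hc0 : 0 < √((n : ℝ) + 1) := by positivity
        set x := √(n : ℝ)
        set y := √((n : ℝ) + 1)
        have hxy : x ≤ y := Real.sqrt_le_sqrt (by linarith)
        calc min (b : ℝ) (n + 1) / ((n + 1) * y) ≤ b / ((n + 1) * y) := by
              gcongr; exact min_le_left _ _
          _ = b * (1 / (y ^ 2 * y)) := by rw [hc]; ring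
          _ ≤ b * (2 / x - 2 / y) := by
              gcongr
              have e : 2 / x - 2 / y = 2 * (y - x) / (x * y) := by field_simp
              have hd : (y - x) * (y + x) = 1 := by nlinarith
              rw [e, div_le_div_iff₀ (by positivity) (by positivity)]
              have : 1 ≤ (y - x) * (2 * y) := by nlinarith
              have h' : x * y * 1 ≤ (y * y) * ((y - x) * (2 * y)) := by
                gcongr
              nlinarith
          _ = 2 * b / x - 2 * b / y := by ring
      linarith
  have hmono : ∑ m ∈ range n, min (b : ℝ) (m + 1) / ((m + 1) * √((m : ℝ) + 1)) ≤
      ∑ m ∈ range (max b n), min (b : ℝ) (m + 1) / ((m + 1) * √((m : ℝ) + 1)) := by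
    refine sum_le_sum_of_subset_of_nonneg (range_mono (le_max_right b n)) fun m _ _ => ?_
    positivity
  refine hmono.trans ((key _ (le_max_left b n)).trans ?_)
  have : 0 ≤ 2 * (b : ℝ) / √(max b n : ℕ) := by positivity
  linarith

end Estimates

section ReachSums
open Finset

variable {ι : Type*} [Fintype ι] [DecidableEq ι] {N : ℕ}

theorem Nat.choose_mul_succ_mul_succ (a b : ℕ) :
    (a + b).choose a * ((a + b + 1) * (a + b + 2)) =
      (a + 1 + (b + 1)).choose (a + 1) * ((a + 1) * (b + 1)) := by
  have h1 := Nat.add_one_mul_choose_eq (a + b + 1) a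
  have h2 := Nat.add_one_mul_choose_eq (a + b) b
  rw [← Nat.choose_symm_of_eq_add (show a + b + 1 = a + (b + 1) by ring),
    ← Nat.choose_symm_add] at h2
  rw [show a + 1 + (b + 1) = a + b + 1 + 1 by ring]
  calc _ = ((a + b + 1) * (a + b).choose a) * (a + b + 1 + 1) := by ring
    _ = (a + b + 1 + 1) * (a + b + 1).choose a * (b + 1) := by rw [h2]; ring
    _ = _ := by rw [h1]; ring

theorem card_reach_eq_mul_le (hN : Fintype.card ι + 1 = N) {p q : ℕ} (hp : 1 ≤ p) (hq : 1 ≤ q)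
    (hpq : p + q = N) (j : ι) :
    (#{u : ι → Fin N | reach j u = p} : ℝ) * (p * q * √((p : ℝ) * q)) ≤
      2 * (N : ℝ) ^ Fintype.card ι * √(N : ℝ) := by
  have hp' : (0 : ℝ) < p := by exact_mod_cast hp
  have hq' : (0 : ℝ) < q := by exact_mod_cast hq
  have h1 : (#{u : ι → Fin N | reach j u = p} : ℝ) * ((p : ℝ) ^ 2 * (q : ℝ) ^ 2) ≤
      N * (N - 2).choose (p - 1) * ((p : ℝ) ^ p * (q : ℝ) ^ q) := by
    exact_mod_cast card_reach_eq_le hN hp hq hpq j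
  have h2 : ((N - 2).choose (p - 1) : ℝ) * (((N : ℝ) - 1) * N) =
      ((p + q).choose p : ℝ) * (p * q) := by
    obtain ⟨a, rfl⟩ := Nat.exists_eq_add_of_le' hp
    obtain ⟨b, rfl⟩ := Nat.exists_eq_add_of_le' hq
    have := Nat.choose_mul_succ_mul_succ a b
    rw [← hpq, show a + 1 + (b + 1) - 2 = a + b by omega, Nat.add_sub_cancel]
    have h : ((a + 1 + (b + 1) : ℕ) : ℝ) - 1 = ((a + b + 1 : ℕ) : ℝ) := by push_cast; ring
    rw [h, show a + 1 + (b + 1) = a + b + 2 by ring]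
    rw [show a + 1 + (b + 1) = a + b + 2 by ring] at this
    exact_mod_cast this
  have h3 := choose_mul_pow_mul_pow_le hp hq
  rw [hpq] at h2 h3
  set R : ℝ := (#{u : ι → Fin N | reach j u = p} : ℝ)
  have hN2 : (2 : ℝ) ≤ N := by
    have : 2 ≤ N := by omega
    exact_mod_cast this
  have h4 : ((N : ℝ) - 1) * (R * (p * q)) ≤ (N.choose p : ℝ) * ((p : ℝ) ^ p * (q : ℝ) ^ q) := by
    have h5 := mul_le_mul_of_nonneg_right h1 (show (0 : ℝ) ≤ N - 1 by linarith)
    have h6 : (N : ℝ) * (N - 2).choose (p - 1) * ((p : ℝ) ^ p * (q : ℝ) ^ q) * (N - 1) =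
        ((N.choose p : ℝ) * ((p : ℝ) ^ p * (q : ℝ) ^ q)) * (p * q) := by
      linear_combination ((p : ℝ) ^ p * (q : ℝ) ^ q) * h2
    rw [h6] at h5
    refine le_of_mul_le_mul_right (le_trans (le_of_eq ?_) h5) (show (0 : ℝ) < p * q by positivity)
    ring
  have hR : 0 ≤ R * (p * q) := by positivity
  have h7 : (N : ℝ) * (R * (p * q * √((p : ℝ) * q))) ≤
      N * (2 * (N : ℝ) ^ Fintype.card ι * √(N : ℝ)) := by
    calc (N : ℝ) * (R * (p * q * √((p : ℝ) * q)))
        ≤ (2 * (N - 1)) * (R * (p * q * √((p : ℝ) * q))) := by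
          gcongr
          linarith
      _ = 2 * (((N : ℝ) - 1) * (R * (p * q)) * √((p : ℝ) * q)) := by ring
      _ ≤ 2 * ((N.choose p : ℝ) * ((p : ℝ) ^ p * (q : ℝ) ^ q) * √((p : ℝ) * q)) := by gcongr
      _ ≤ 2 * ((N : ℝ) ^ N * √(N : ℝ)) := by gcongr
      _ = N * (2 * (N : ℝ) ^ Fintype.card ι * √(N : ℝ)) := by
          have : (N : ℝ) ^ N = (N : ℝ) ^ (Fintype.card ι + 1) := by rw [hN]
          rw [this, pow_succ]; ring
  exact le_of_mul_le_mul_left h7 (by linarith)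

theorem sqrt_div_mul_le {x y : ℝ} (hx : 0 < x) (hy : 0 < y) :
    √(x + y) / √(x * y) ≤ 1 / √x + 1 / √y := by
  rw [Real.sqrt_mul hx.le]
  have hx' := Real.sqrt_pos.2 hx
  have hy' := Real.sqrt_pos.2 hy
  have h : √(x + y) ≤ √x + √y := by
    rw [Real.sqrt_le_iff]
    refine ⟨by positivity, ?_⟩
    nlinarith [Real.sq_sqrt hx.le, Real.sq_sqrt hy.le, mul_pos hx' hy']
  rw [div_add_div _ _ (by positivity) (by positivity)]
  gcongr
  linarith

theorem card_reach_eq_mul_mul_le (hN : Fintype.card ι + 1 = N) {p q : ℕ} (hp : 1 ≤ p)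
    (hq : 1 ≤ q) (hpq : p + q = N) (j : ι) :
    (#{u : ι → Fin N | reach j u = p} : ℝ) * (p * q) ≤
      2 * (N : ℝ) ^ Fintype.card ι * (1 / √(p : ℝ) + 1 / √(q : ℝ)) := by
  have hp' : (0 : ℝ) < p := by exact_mod_cast hp
  have hq' : (0 : ℝ) < q := by exact_mod_cast hq
  have h := card_reach_eq_mul_le hN hp hq hpq j
  have h2 := sqrt_div_mul_le hp' hq'
  have h3 : ((p : ℝ) + q) = N := by exact_mod_cast hpq
  rw [h3] at h2
  have h4 : 0 < √((p : ℝ) * q) := by positivity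
  calc _ ≤ 2 * (N : ℝ) ^ Fintype.card ι * √(N : ℝ) / √((p : ℝ) * q) := by
        rw [le_div_iff₀ h4]; linarith
    _ = 2 * (N : ℝ) ^ Fintype.card ι * (√(N : ℝ) / √((p : ℝ) * q)) := by ring
    _ ≤ _ := by gcongr

theorem card_reach_eq_le_add (hN : Fintype.card ι + 1 = N) {p q : ℕ} (hp : 1 ≤ p)
    (hq : 1 ≤ q) (hpq : p + q = N) (j : ι) :
    (N : ℝ) * #{u : ι → Fin N | reach j u = p} ≤
      4 * (N : ℝ) ^ Fintype.card ι * (1 / (p * √(p : ℝ)) + 1 / (q * √(q : ℝ))) := by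
  have hp' : (0 : ℝ) < p := by exact_mod_cast hp
  have hq' : (0 : ℝ) < q := by exact_mod_cast hq
  have h := card_reach_eq_mul_mul_le hN hp hq hpq j
  have h3 : (N : ℝ) = p + q := by exact_mod_cast hpq.symm
  have hx : 0 < 1 / √(p : ℝ) := by positivity
  have hy : 0 < 1 / √(q : ℝ) := by positivity
  have hx2 : (1 / √(p : ℝ)) ^ 2 = 1 / p := by rw [div_pow, Real.sq_sqrt hp'.le, one_pow]
  have hy2 : (1 / √(q : ℝ)) ^ 2 = 1 / q := by rw [div_pow, Real.sq_sqrt hq'.le, one_pow]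
  have e1 : 1 / (p * √(p : ℝ)) = (1 / √(p : ℝ)) ^ 3 := by
    rw [pow_succ, hx2]; field_simp
  have e2 : 1 / (q * √(q : ℝ)) = (1 / √(q : ℝ)) ^ 3 := by
    rw [pow_succ, hy2]; field_simp
  rw [e1, e2]
  set x := 1 / √(p : ℝ)
  set y := 1 / √(q : ℝ)
  set R : ℝ := (#{u : ι → Fin N | reach j u = p} : ℝ)
  calc (N : ℝ) * R = R * (p * q) * (x ^ 2 + y ^ 2) := by
        rw [hx2, hy2, h3]; field_simp; ring
    _ ≤ 2 * (N : ℝ) ^ Fintype.card ι * (x + y) * (x ^ 2 + y ^ 2) := by gcongr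
    _ = 2 * (N : ℝ) ^ Fintype.card ι * ((x + y) * (x ^ 2 + y ^ 2)) := by ring
    _ ≤ 2 * (N : ℝ) ^ Fintype.card ι * (2 * (x ^ 3 + y ^ 3)) := by
        refine mul_le_mul_of_nonneg_left ?_ (by positivity)
        nlinarith [mul_nonneg (add_nonneg hx.le hy.le) (sq_nonneg (x - y))]
    _ = _ := by ring

theorem sum_apply_reach (hN : Fintype.card ι + 1 = N) (j : ι) (f : ℕ → ℝ) (h0 : f 0 = 0)
    (h1 : f N = 0) :
    ∑ u : ι → Fin N, f (reach j u) = ∑ a ∈ range (Fintype.card ι),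
      (#{u : ι → Fin N | reach j u = a + 1} : ℝ) * f (a + 1) := by
  have h : ∑ u : ι → Fin N, f (reach j u) = ∑ m ∈ range (Fintype.card ι + 2),
      (#{u : ι → Fin N | reach j u = m} : ℝ) * f m := by
    rw [← sum_fiberwise_of_maps_to (g := reach j) (t := range (Fintype.card ι + 2))
      fun u _ => by rw [mem_range]; have := reach_le j u; omega]
    refine sum_congr rfl fun m _ => ?_
    rw [sum_congr rfl fun u hu => by rw [(mem_filter.1 hu).2], sum_const, nsmul_eq_mul]
  rw [h, sum_range_succ, hN, h1, ← hN, sum_range_succ', h0]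
  simp

/-- On average `reach * (N - reach)` is of order `N ^ (3 / 2)` only. -/
theorem sum_reach_mul_le (hN : Fintype.card ι + 1 = N) (j : ι) :
    ∑ u : ι → Fin N, (reach j u : ℝ) * (N - reach j u) ≤
      8 * (N : ℝ) ^ Fintype.card ι * √(N : ℝ) := by
  rw [sum_apply_reach hN j (fun m => (m : ℝ) * (N - m)) (by simp) (by simp)]
  set n := Fintype.card ι
  have hs := sum_one_div_sqrt_le n
  have hnN : √(n : ℝ) ≤ √(N : ℝ) := Real.sqrt_le_sqrt (by rw [← hN]; push_cast; linarith)
  calc _ ≤ ∑ a ∈ range n, 2 * (N : ℝ) ^ n *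
          (1 / √((a : ℝ) + 1) + 1 / √(((n - 1 - a : ℕ) : ℝ) + 1)) := by
        refine sum_le_sum fun a ha => ?_
        rw [mem_range] at ha
        have := card_reach_eq_mul_mul_le hN (p := a + 1) (q := n - 1 - a + 1) (by omega) (by omega)
          (by omega) j
        have e : (N : ℝ) - ((a + 1 : ℕ) : ℝ) = ((n - 1 - a + 1 : ℕ) : ℝ) := by
          rw [sub_eq_iff_eq_add]; norm_cast; omega
        rw [e]
        exact_mod_cast this
    _ = 2 * (N : ℝ) ^ n * (2 * ∑ a ∈ range n, 1 / √((a : ℝ) + 1)) := by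
        rw [← mul_sum, sum_add_distrib,
          sum_range_reflect (fun a : ℕ => 1 / √((a : ℝ) + 1)) n]
        ring
    _ ≤ 2 * (N : ℝ) ^ n * (2 * (2 * √(N : ℝ))) := by gcongr; linarith
    _ = _ := by ring

theorem sum_min_reach_mul_le (hN : Fintype.card ι + 1 = N) (j : ι) {b c : ℕ} (hbc : c + b = N) :
    ∑ u : ι → Fin N, min (c : ℝ) (reach j u) * (N - max (c : ℝ) (reach j u)) ≤
      24 * (N : ℝ) ^ Fintype.card ι * √(b : ℝ) := by
  have hN0 : (0 : ℝ) < N := by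
    have : 0 < N := by omega
    exact_mod_cast this
  have hcN : (c : ℝ) ≤ N := by
    have : c ≤ N := by omega
    exact_mod_cast this
  have hbN : (b : ℝ) ≤ N := by
    have : b ≤ N := by omega
    exact_mod_cast this
  rw [sum_apply_reach hN j (fun m => min (c : ℝ) m * (N - max (c : ℝ) m)) (by simp)
    (by simp [hcN])]
  set n := Fintype.card ι
  have hs := sum_one_div_sqrt_le n
  have hs2 := sum_min_div_le b n
  have hnN : √(n : ℝ) ≤ √(N : ℝ) := Real.sqrt_le_sqrt (by rw [← hN]; push_cast; linarith)
  refine le_of_mul_le_mul_left ?_ hN0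
  calc _ ≤ ∑ a ∈ range n, 4 * (N : ℝ) ^ n * (b * (1 / √((a : ℝ) + 1)) +
          N * (min (b : ℝ) (((n - 1 - a : ℕ) : ℝ) + 1) / ((((n - 1 - a : ℕ) : ℝ) + 1) *
            √(((n - 1 - a : ℕ) : ℝ) + 1)))) := by
        rw [mul_sum]
        refine sum_le_sum fun a ha => ?_
        rw [mem_range] at ha
        have h := card_reach_eq_le_add hN (p := a + 1) (q := n - 1 - a + 1) (by omega) (by omega)
          (by omega) j
        have e : (N : ℝ) = (a + 1) + (((n - 1 - a : ℕ) : ℝ) + 1) := by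
          norm_cast; omega
        have eb : (N : ℝ) = c + b := by exact_mod_cast hbc.symm
        push_cast at h ⊢
        set q : ℝ := ((n - 1 - a : ℕ) : ℝ) + 1
        have hq : 0 < q := by positivity
        set p : ℝ := (a : ℝ) + 1
        have hp : 0 < p := by positivity
        have e2 : (N : ℝ) - max (c : ℝ) p = min (b : ℝ) q := by
          rw [sub_eq_iff_eq_add]
          rcases le_total (c : ℝ) p with hcp | hcp
          · rw [max_eq_right hcp, min_eq_right (by linarith)]; linarith
          · rw [max_eq_left hcp, min_eq_left (by linarith)]; linarith
        rw [e2]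
        have hmin : 0 ≤ min (c : ℝ) p * min (b : ℝ) q := by positivity
        calc _ = (N : ℝ) * (#{u : ι → Fin N | reach j u = a + 1}) *
              (min (c : ℝ) p * min (b : ℝ) q) := by ring
          _ ≤ 4 * (N : ℝ) ^ n * (1 / (p * √p) + 1 / (q * √q)) *
              (min (c : ℝ) p * min (b : ℝ) q) := by gcongr
          _ = 4 * (N : ℝ) ^ n * (min (c : ℝ) p * min (b : ℝ) q * (1 / (p * √p)) +
              min (c : ℝ) p * min (b : ℝ) q * (1 / (q * √q))) := by ring
          _ ≤ 4 * (N : ℝ) ^ n * (p * b * (1 / (p * √p)) + N * min (b : ℝ) q * (1 / (q * √q))) := by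
            gcongr
            · exact min_le_right _ _
            · exact min_le_left _ _
            · exact (min_le_left _ _).trans hcN
          _ = _ := by field_simp
    _ = 4 * (N : ℝ) ^ n * (b * (∑ a ∈ range n, 1 / √((a : ℝ) + 1)) +
          N * ∑ a ∈ range n, min (b : ℝ) (a + 1) / ((a + 1) * √((a : ℝ) + 1))) := by
        rw [← mul_sum, sum_add_distrib, ← mul_sum, ← mul_sum,
          sum_range_reflect (fun a : ℕ => min (b : ℝ) (a + 1) / ((a + 1) * √((a : ℝ) + 1))) n]
    _ ≤ 4 * (N : ℝ) ^ n * (b * (2 * √(N : ℝ)) + N * (4 * √(b : ℝ))) := by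
        gcongr; linarith
    _ ≤ 4 * (N : ℝ) ^ n * (N * (2 * √(b : ℝ)) + N * (4 * √(b : ℝ))) := by
        gcongr 4 * (N : ℝ) ^ n * (?_ + _)
        have h1 : √(b : ℝ) ≤ √(N : ℝ) := Real.sqrt_le_sqrt hbN
        have h2 : √(b : ℝ) * √b = b := Real.mul_self_sqrt (by positivity)
        have h3 : √(N : ℝ) * √N = N := Real.mul_self_sqrt (by positivity)
        have h4 : 0 ≤ √(b : ℝ) * √(N : ℝ) * (√(N : ℝ) - √b) :=
          mul_nonneg (by positivity) (sub_nonneg.2 h1)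
        linear_combination 2 * h4 - 2 * √(N : ℝ) * h2 + 2 * √(b : ℝ) * h3
    _ = _ := by ring

end ReachSums

section Comparison
open Finset

variable {ι : Type*} {N : ℕ}

/-- The indicator function of the box `{u | ∀ i ∈ J, u i < c i}`. -/
noncomputable def boxIndicator (c : ι → ℕ) (J : Finset ι) (u : ι → Fin N) : ℝ :=
  ∏ i ∈ J, if (u i : ℕ) < c i then 1 else 0

theorem boxIndicator_nonneg (c : ι → ℕ) (J : Finset ι) (u : ι → Fin N) :
    0 ≤ boxIndicator c J u :=
  prod_nonneg fun i _ => by split_ifs <;> norm_num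

theorem boxIndicator_le_one (c : ι → ℕ) (J : Finset ι) (u : ι → Fin N) :
    boxIndicator c J u ≤ 1 :=
  prod_le_one (fun i _ => by split_ifs <;> norm_num) fun i _ => by split_ifs <;> norm_num

/-- The indicator function of the set of parking functions. -/
noncomputable def parkingIndicator [Fintype ι] (u : ι → Fin N) : ℝ := if IsParking u then 1 else 0

variable [DecidableEq ι]

theorem boxIndicator_update (c : ι → ℕ) {J : Finset ι} {j : ι} (hj : j ∉ J) (u : ι → Fin N)
    (x : Fin N) : boxIndicator c J (Function.update u j x) = boxIndicator c J u :=
  prod_congr rfl fun i hi => by rw [Function.update_of_ne (ne_of_mem_of_not_mem hi hj)]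

variable [Fintype ι]

/-- Resampling a coordinate is a reversible operation. -/
theorem sum_update_comm (j : ι) (H : (ι → Fin N) → (ι → Fin N) → ℝ) :
    ∑ u, ∑ x, H u (Function.update u j x) = ∑ u, ∑ x, H (Function.update u j x) u := by
  rw [← Fintype.sum_prod_type', ← Fintype.sum_prod_type']
  let e : (ι → Fin N) × Fin N → (ι → Fin N) × Fin N := fun w => (Function.update w.1 j w.2, w.1 j)
  have he : Function.Involutive e := fun w => by simp [e]
  refine Fintype.sum_equiv he.toPerm _ _ fun w => ?_
  simp [e]

theorem sum_sum_update (j : ι) (g : (ι → Fin N) → ℝ) :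
    ∑ u, ∑ x, g (Function.update u j x) = N * ∑ u, g u := by
  rw [sum_update_comm j fun _ v => g v]
  simp [mul_sum]

theorem parkingIndicator_update (u : ι → Fin N) (j : ι) (x : Fin N) :
    parkingIndicator (Function.update u j x) = if (x : ℕ) < reach j u then 1 else 0 := by
  simp only [parkingIndicator, isParking_update_iff]

theorem mul_sum_parkingIndicator (hN : Fintype.card ι + 1 = N) :
    (N : ℝ) * ∑ u : ι → Fin N, parkingIndicator u = (N : ℝ) ^ Fintype.card ι := by
  simp only [parkingIndicator, sum_boole]
  rw [mul_comm]
  exact_mod_cast card_isParking_mul hN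

theorem sum_ite_val_lt {m : ℕ} (hm : m ≤ N) :
    ∑ x : Fin N, (if (x : ℕ) < m then (1 : ℝ) else 0) = m := by
  rw [Fin.sum_univ_eq_sum_range (fun x => if x < m then (1 : ℝ) else 0) N, sum_boole]
  have : ({x ∈ range N | x < m} : Finset ℕ) = range m := by
    ext x
    simp only [mem_filter, mem_range]
    omega
  rw [this, card_range]

theorem sum_abs_parkingIndicator_update_sub_le (hN : Fintype.card ι + 1 = N) (j : ι) :
    (N : ℝ) * ∑ u : ι → Fin N, ∑ x,
      |parkingIndicator u - parkingIndicator (Function.update u j x)| ≤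
      16 * (N : ℝ) ^ Fintype.card ι * √(N : ℝ) := by
  rw [← sum_sum_update j]
  have h : ∀ u : ι → Fin N, ∑ y, ∑ x, |parkingIndicator (Function.update u j y) -
      parkingIndicator (Function.update (Function.update u j y) j x)| =
      2 * ((reach j u : ℝ) * (N - reach j u)) := by
    intro u
    simp only [Function.update_idem, parkingIndicator_update]
    have hs := sum_ite_val_lt (reach_le j u)
    set f : Fin N → ℝ := fun x => if (x : ℕ) < reach j u then 1 else 0 with hf
    have h1 : ∀ x y, |f y - f x| = f y * (1 - f x) + (1 - f y) * f x := by
      intro x y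
      simp only [hf]
      split_ifs <;> norm_num
    change ∑ y, ∑ x, |f y - f x| = _
    simp only [h1, sum_add_distrib, ← mul_sum, ← sum_mul, sum_sub_distrib]
    rw [hs]
    simp only [sum_const, card_univ, Fintype.card_fin, nsmul_eq_mul]
    ring
  rw [sum_congr rfl fun u _ => h u, ← mul_sum]
  have := sum_reach_mul_le hN j
  linarith

/-- A test function that depends on the coordinates in `J` hardly distinguishes parking functions
from all functions. -/
theorem abs_sum_parkingIndicator_mul_sub_le (hN : Fintype.card ι + 1 = N) (J : Finset ι) :
    ∀ φ : (ι → Fin N) → ℝ, (∀ u, |φ u| ≤ 1) → (∀ u v, (∀ i ∈ J, u i = v i) → φ u = φ v) →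
      N * |N * ∑ u, parkingIndicator u * φ u - ∑ u, φ u| ≤
        #J * (16 * (N : ℝ) ^ Fintype.card ι * √(N : ℝ)) := by
  have hN0 : (0 : ℝ) < N := by
    have : 0 < N := by omega
    exact_mod_cast this
  induction J using Finset.induction_on with
  | empty =>
    intro φ _ hφ
    have h0 : ∀ u, φ u = φ fun _ => ⟨0, by omega⟩ := fun u => hφ u _ (by simp)
    rw [sum_congr rfl fun u _ => by rw [h0 u], ← sum_mul, sum_congr rfl fun u _ => h0 u, ← mul_assoc,
      mul_sum_parkingIndicator hN]
    simp
  | insert j J hj ih =>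
    intro φ hφ1 hφ
    set ψ : (ι → Fin N) → ℝ := fun u => (∑ x, φ (Function.update u j x)) / N with hψ
    have hψ1 : ∀ u, |ψ u| ≤ 1 := by
      intro u
      rw [hψ, abs_div, abs_of_pos hN0, div_le_one hN0]
      refine (abs_sum_le_sum_abs _ _).trans ((sum_le_sum fun x _ => hφ1 _).trans ?_)
      simp
    have hψJ : ∀ u v, (∀ i ∈ J, u i = v i) → ψ u = ψ v := by
      intro u v huv
      simp only [hψ]
      congr 1
      refine sum_congr rfl fun x _ => hφ _ _ fun i hi => ?_
      rcases eq_or_ne i j with rfl | hij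
      · simp
      · simp [hij, huv i (mem_of_mem_insert_of_ne hi hij)]
    have h1 := ih ψ hψ1 hψJ
    have h2 : ∑ u, ψ u = ∑ u, φ u := by
      simp only [hψ]
      rw [← sum_div, sum_sum_update]
      field_simp
    have h3 : N * ∑ u, parkingIndicator u * φ u - N * ∑ u, parkingIndicator u * ψ u =
        ∑ u, ∑ x, (parkingIndicator u - parkingIndicator (Function.update u j x)) * φ u := by
      have e1 : N * ∑ u, parkingIndicator u * φ u =
          ∑ u : ι → Fin N, ∑ x : Fin N, parkingIndicator u * φ u := by simp [mul_sum]
      have e2 : N * ∑ u, parkingIndicator u * ψ u =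
          ∑ u : ι → Fin N, ∑ x : Fin N, parkingIndicator (Function.update u j x) * φ u := by
        rw [← sum_update_comm j fun u v => parkingIndicator u * φ v, mul_sum]
        refine sum_congr rfl fun u _ => ?_
        rw [← mul_sum, hψ]
        field_simp
      rw [e1, e2, ← sum_sub_distrib]
      refine sum_congr rfl fun u _ => ?_
      rw [← sum_sub_distrib]
      exact sum_congr rfl fun x _ => by ring
    have h4 : |N * ∑ u, parkingIndicator u * φ u - N * ∑ u, parkingIndicator u * ψ u| ≤
        ∑ u : ι → Fin N, ∑ x,
          |parkingIndicator u - parkingIndicator (Function.update u j x)| := by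
      rw [h3]
      refine (abs_sum_le_sum_abs _ _).trans (sum_le_sum fun u _ => ?_)
      refine (abs_sum_le_sum_abs _ _).trans (sum_le_sum fun x _ => ?_)
      rw [abs_mul]
      exact mul_le_of_le_one_right (abs_nonneg _) (hφ1 u)
    have h5 := sum_abs_parkingIndicator_update_sub_le hN j
    have h6 := abs_sub_le (N * ∑ u, parkingIndicator u * φ u) (N * ∑ u, parkingIndicator u * ψ u)
      (∑ u, φ u)
    rw [h2] at h1
    rw [card_insert_of_notMem hj]
    push_cast
    have h7 := mul_le_mul_of_nonneg_left (h6.trans (add_le_add h4 le_rfl)) hN0.le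
    rw [mul_add] at h7
    linarith

theorem mul_sum_boxIndicator_insert_sub (c : ι → ℕ) {J : Finset ι} {j : ι} (hj : j ∉ J)
    (hc : c j ≤ N) :
    (N : ℝ) * (N * ∑ u : ι → Fin N, parkingIndicator u * boxIndicator c (insert j J) u) -
      c j * (N * ∑ u : ι → Fin N, parkingIndicator u * boxIndicator c J u) =
      ∑ u : ι → Fin N, boxIndicator c J u *
        (min (c j : ℝ) (reach j u) * (N - max (c j : ℝ) (reach j u))) := by
  have h1 : (N : ℝ) * (N * ∑ u : ι → Fin N,
        parkingIndicator u * boxIndicator c (insert j J) u) -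
      c j * (N * ∑ u : ι → Fin N, parkingIndicator u * boxIndicator c J u) =
      N * ∑ u : ι → Fin N, parkingIndicator u * boxIndicator c J u *
        (N * (if (u j : ℕ) < c j then 1 else 0) - c j) := by
    simp only [boxIndicator, prod_insert hj, mul_sub, sum_sub_distrib, mul_sum]
    congr 1
    · exact sum_congr rfl fun u _ => by ring
    · exact sum_congr rfl fun u _ => by ring
  rw [h1, ← sum_sum_update j]
  refine sum_congr rfl fun u _ => ?_
  simp only [parkingIndicator_update, boxIndicator_update c hj, Function.update_self]
  have h2 : ∀ x : Fin N, (if (x : ℕ) < reach j u then (1 : ℝ) else 0) * boxIndicator c J u *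
      (N * (if (x : ℕ) < c j then 1 else 0) - c j) =
      boxIndicator c J u * (N * (if (x : ℕ) < min (c j) (reach j u) then 1 else 0) -
        c j * (if (x : ℕ) < reach j u then 1 else 0)) := by
    intro x
    simp only [lt_min_iff]
    by_cases h3 : (x : ℕ) < reach j u <;> by_cases h4 : (x : ℕ) < c j <;> simp [h3, h4]
  rw [sum_congr rfl fun x _ => h2 x, ← mul_sum, sum_sub_distrib, ← mul_sum, ← mul_sum,
    sum_ite_val_lt (reach_le j u), sum_ite_val_lt ((min_le_left _ _).trans hc)]
  congr 1
  rw [Nat.cast_min, mul_sub, min_mul_max]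
  ring

theorem one_sub_mul_sqrt_add_sqrt_le {k x y : ℝ} (hk : 0 ≤ k) (hx : 0 ≤ x) (hx1 : x ≤ 1)
    (hy : 0 ≤ y) :
    (1 - x) * (√k * √y) + √x ≤ √(k + 1) * √(1 - (1 - x) * (1 - y)) := by
  rw [← Real.sqrt_mul (show 0 ≤ k + 1 by positivity)]
  refine Real.le_sqrt_of_sq_le ?_
  have hk' := Real.sq_sqrt hk
  have hx' := Real.sq_sqrt hx
  have hy' := Real.sq_sqrt hy
  set a := √k
  set b := √x
  set d := √y
  have h1 : 0 ≤ (1 - x) * x * y * (k + 1) := by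
    have : 0 ≤ 1 - x := by linarith
    positivity
  have h2 : ((1 - x) * (a * d) + b) ^ 2 ≤ (a ^ 2 + 1) * ((1 - x) ^ 2 * d ^ 2 + b ^ 2) := by
    nlinarith [sq_nonneg (a * b - (1 - x) * d)]
  rw [hk', hx', hy'] at h2
  nlinarith

/-- Parking functions and all functions give a box with sides `c i` almost the same mass. -/
theorem sum_boxIndicator_sub_bounds (hN : Fintype.card ι + 1 = N) (c : ι → ℕ) (hc : ∀ i, c i ≤ N)
    (J : Finset ι) :
    0 ≤ N * ∑ u : ι → Fin N, parkingIndicator u * boxIndicator c J u -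
        (∏ i ∈ J, (c i / N : ℝ)) * (N : ℝ) ^ Fintype.card ι ∧
      N * ∑ u : ι → Fin N, parkingIndicator u * boxIndicator c J u -
        (∏ i ∈ J, (c i / N : ℝ)) * (N : ℝ) ^ Fintype.card ι ≤
        24 * (N : ℝ) ^ Fintype.card ι / √(N : ℝ) *
          (√(#J : ℝ) * √(1 - ∏ i ∈ J, (c i / N : ℝ))) := by
  have hN0 : (0 : ℝ) < N := by
    have : 0 < N := by omega
    exact_mod_cast this
  have hc' : ∀ i, (c i : ℝ) ≤ N := fun i => by exact_mod_cast hc i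
  induction J using Finset.induction_on with
  | empty =>
    simp only [boxIndicator, prod_empty, mul_one, mul_sum_parkingIndicator hN]
    simp
  | insert j J hj ih =>
    obtain ⟨ih1, ih2⟩ := ih
    have hrec := mul_sum_boxIndicator_insert_sub c hj (hc j)
    set P : ℝ := ∏ i ∈ J, (c i / N : ℝ) with hP
    rw [prod_insert hj, ← hP, card_insert_of_notMem hj]
    have hP1 : P ≤ 1 := prod_le_one (fun i _ => by positivity) fun i _ => by
      rw [div_le_one hN0]; exact hc' i
    set Q : ℝ := N * ∑ u : ι → Fin N, parkingIndicator u * boxIndicator c J u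
    set Q' : ℝ := N * ∑ u : ι → Fin N, parkingIndicator u * boxIndicator c (insert j J) u
    set n := Fintype.card ι
    have hpos : ∀ u : ι → Fin N,
        0 ≤ min (c j : ℝ) (reach j u) * (N - max (c j : ℝ) (reach j u)) := fun u => by
      have : (reach j u : ℝ) ≤ N := by exact_mod_cast reach_le j u
      exact mul_nonneg (by positivity) (sub_nonneg.2 (max_le (hc' j) this))
    have hE0 : 0 ≤ (N : ℝ) * Q' - c j * Q := by
      rw [hrec]
      exact sum_nonneg fun u _ => mul_nonneg (boxIndicator_nonneg _ _ _) (hpos u)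
    have hE1 : (N : ℝ) * Q' - c j * Q ≤ 24 * (N : ℝ) ^ n * √((N - c j : ℕ) : ℝ) := by
      rw [hrec]
      refine le_trans (sum_le_sum fun u _ => ?_)
        (sum_min_reach_mul_le hN j (Nat.add_sub_cancel' (hc j)))
      exact mul_le_of_le_one_left (hpos u) (boxIndicator_le_one _ _ _)
    set x : ℝ := ((N - c j : ℕ) : ℝ) / N with hx
    have hcx : (c j : ℝ) / N = 1 - x := by
      rw [hx, Nat.cast_sub (hc j)]; field_simp; ring
    have hx0 : 0 ≤ x := by positivity
    have hx1 : x ≤ 1 := by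
      have : (0 : ℝ) ≤ c j / N := by positivity
      linarith
    have hQ : Q' - c j / N * P * (N : ℝ) ^ n =
        (1 - x) * (Q - P * (N : ℝ) ^ n) + (N * Q' - c j * Q) / N := by
      rw [← hcx]; field_simp; ring
    rw [hQ, hcx]
    have hx1' : 0 ≤ 1 - x := by linarith
    refine ⟨by positivity, ?_⟩
    have hsx : √((N - c j : ℕ) : ℝ) / N = √x / √(N : ℝ) := by
      rw [hx, Real.sqrt_div' _ hN0.le, div_div, Real.mul_self_sqrt hN0.le]
    have hs := one_sub_mul_sqrt_add_sqrt_le (Nat.cast_nonneg (α := ℝ) #J) hx0 hx1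
      (sub_nonneg.2 hP1)
    rw [sub_sub_cancel] at hs
    push_cast
    calc (1 - x) * (Q - P * (N : ℝ) ^ n) + (N * Q' - c j * Q) / N
        ≤ (1 - x) * (24 * (N : ℝ) ^ n / √(N : ℝ) * (√(#J : ℝ) * √(1 - P))) +
          24 * (N : ℝ) ^ n * √((N - c j : ℕ) : ℝ) / N := by gcongr
      _ = 24 * (N : ℝ) ^ n / √(N : ℝ) * ((1 - x) * (√(#J : ℝ) * √(1 - P)) + √x) := by
          rw [mul_div_assoc (24 * (N : ℝ) ^ n), hsx]; ring
      _ ≤ _ := by gcongr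

end Comparison

section ParkingLaw
open Finset

theorem mem_parkingFunctions_iff {n : ℕ} {π : Fin n → Fin n} :
    π ∈ parkingFunctions n ↔ IsParking fun i => (π i).castSucc := by
  have hmono := Tuple.monotone_sort π
  constructor
  · intro h s hs
    have hs' : s ≤ n := by omega
    have hinj : Function.Injective fun l : Fin s => Tuple.sort π (Fin.castLE hs' l) :=
      (Tuple.sort π).injective.comp (Fin.castLE_injective hs')
    calc s = #(univ.image fun l : Fin s => Tuple.sort π (Fin.castLE hs' l)) := by
          rw [card_image_of_injective _ hinj, card_univ, Fintype.card_fin]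
      _ ≤ _ := card_le_card fun i hi => by
          obtain ⟨l, -, rfl⟩ := mem_image.1 hi
          have h1 : (π (Tuple.sort π (Fin.castLE hs' l)) : ℕ) ≤ l := h (Fin.castLE hs' l)
          simp only [mem_filter, mem_univ, true_and, Fin.val_castSucc]
          omega
  · intro h i
    by_contra hi
    have h1 : (i : ℕ) + 1 ≤ #{l : Fin n | ((π l).castSucc : ℕ) < i + 1} := h (i + 1) (by omega)
    have h2 : #{l : Fin n | ((π l).castSucc : ℕ) < i + 1} ≤ #((Iio i).image (Tuple.sort π)) := by
      refine card_le_card fun l hl => ?_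
      simp only [mem_filter, mem_univ, true_and, Fin.val_castSucc] at hl
      rw [mem_image]
      refine ⟨(Tuple.sort π).symm l, ?_, by simp⟩
      rw [mem_Iio]
      by_contra hle
      have h3 := hmono (not_lt.1 hle)
      simp only [Function.comp_apply, Equiv.apply_symm_apply] at h3
      rw [Function.comp_apply] at hi
      exact hi (h3.trans (Fin.le_def.2 (by omega)))
    have h4 := h2.trans card_image_le
    rw [Fin.card_Iio] at h4
    omega

theorem IsParking.val_lt {n : ℕ} {u : Fin n → Fin (n + 1)} (hu : IsParking u) (i : Fin n) :
    (u i : ℕ) < n := by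
  have h1 := hu n (by omega)
  have h2 : ({i | (u i : ℕ) < n} : Finset (Fin n)) = univ :=
    eq_univ_of_card _ (le_antisymm (card_le_univ _) (by simpa using h1))
  have := h2 ▸ mem_univ i
  exact (mem_filter.1 this).2

theorem card_castSucc_isParking {n : ℕ} (P : (Fin n → Fin (n + 1)) → Prop) [DecidablePred P] :
    (#{π : Fin n → Fin n | IsParking (fun i => (π i).castSucc) ∧ P fun i => (π i).castSucc} : ℝ) =
      ∑ u : Fin n → Fin (n + 1), parkingIndicator u * if P u then 1 else 0 := by
  have h1 : #{π : Fin n → Fin n | IsParking (fun i => (π i).castSucc) ∧ P fun i => (π i).castSucc} =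
      #{u : Fin n → Fin (n + 1) | IsParking u ∧ P u} := by
    refine card_bij (fun π _ i => (π i).castSucc) ?_ ?_ ?_
    · simp
    · intro π _ π' _ h
      funext i
      exact Fin.castSucc_injective _ (congrFun h i)
    · intro u hu
      rw [mem_filter] at hu
      exact ⟨fun i => ⟨u i, hu.2.1.val_lt i⟩, by simpa using hu.2, rfl⟩
  rw [h1, card_filter]
  push_cast
  refine sum_congr rfl fun u _ => ?_
  unfold parkingIndicator
  by_cases h2 : IsParking u <;> by_cases h3 : P u <;> simp [h2, h3]

theorem parkingLaw_real_eq {n : ℕ} (P : (Fin n → Fin (n + 1)) → Prop) [DecidablePred P] :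
    (parkingLaw n).real {π | P fun i => (π i).castSucc} =
      ((n + 1 : ℕ) : ℝ) * (∑ u : Fin n → Fin (n + 1), parkingIndicator u * if P u then 1 else 0) /
        ((n + 1 : ℕ) : ℝ) ^ n := by
  have h1 : parkingFunctions n =
      (({π : Fin n → Fin n | IsParking fun i => (π i).castSucc} : Finset _) : Set _) := by
    ext π
    simp [mem_parkingFunctions_iff]
  have h2 : {π : Fin n → Fin n | P fun i => (π i).castSucc} =
      (({π : Fin n → Fin n | P fun i => (π i).castSucc} : Finset _) : Set _) := by
    ext π
    simp
  have h3 := mul_sum_parkingIndicator (ι := Fin n) (N := n + 1) (by simp)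
  rw [Fintype.card_fin] at h3
  have h4 := card_castSucc_isParking (n := n) fun _ => True
  simp only [and_true, if_true, mul_one] at h4
  have h5 : ((n + 1 : ℕ) : ℝ) ≠ 0 := by positivity
  rw [MeasureTheory.measureReal_def, parkingLaw, h1, h2, ProbabilityTheory.uniformOn_apply_finset,
    ← filter_and, ENNReal.toReal_div, ENNReal.toReal_natCast, ENNReal.toReal_natCast,
    card_castSucc_isParking, h4, ← h3, mul_div_mul_left _ _ h5]

theorem one_sub_div_pow_le (k n : ℕ) :
    1 - ((n : ℝ) / (n + 1 : ℕ)) ^ k ≤ k / (n + 1 : ℕ) := by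
  have h : (n : ℝ) / (n + 1 : ℕ) = 1 + -(1 / ((n + 1 : ℕ) : ℝ)) := by
    have : ((n + 1 : ℕ) : ℝ) ≠ 0 := by positivity
    field_simp
    push_cast
    ring
  have h2 : 1 / ((n + 1 : ℕ) : ℝ) ≤ 1 := by
    rw [div_le_one (by positivity)]
    push_cast
    linarith [Nat.cast_nonneg (α := ℝ) n]
  have h3 := one_add_mul_le_pow (a := -(1 / ((n + 1 : ℕ) : ℝ))) (by linarith) k
  rw [h]
  have h4 : (k : ℝ) * -(1 / ((n + 1 : ℕ) : ℝ)) = -(k / (n + 1 : ℕ)) := by ring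
  rw [h4] at h3
  linarith

theorem parkingDK_le {k n : ℕ} (hk : k ≤ n) (hn : 1 ≤ n) :
    parkingDK k n hk ≤ 25 * √((k : ℝ) / n) := by
  have : Nonempty (Fin n) := ⟨⟨0, hn⟩⟩
  have hn0 : (0 : ℝ) < n := by exact_mod_cast hn
  have hkn : (k : ℝ) / n ≤ 1 := by
    rw [div_le_one hn0]; exact_mod_cast hk
  refine ciSup_le fun i => ?_
  let c : Fin n → ℕ := fun l => if h : (l : ℕ) < k then (i ⟨l, h⟩ : ℕ) + 1 else 0
  have hc : ∀ l, c l ≤ n + 1 := fun l => by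
    simp only [c]; split_ifs <;> omega
  have hcj : ∀ j : Fin k, c (Fin.castLE hk j) = i j + 1 := fun j => by simp [c]
  let J : Finset (Fin n) := univ.map (Fin.castLEEmb hk)
  have hJ : #J = k := by simp [J]
  have hlaw : (parkingLaw n).real {π | ∀ j : Fin k, π (Fin.castLE hk j) ≤ i j} =
      ((n + 1 : ℕ) : ℝ) * (∑ u : Fin n → Fin (n + 1), parkingIndicator u * boxIndicator c J u) /
        ((n + 1 : ℕ) : ℝ) ^ n := by
    have h1 := parkingLaw_real_eq (n := n) fun u => ∀ l ∈ J, (u l : ℕ) < c l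
    have h2 : {π : Fin n → Fin n | ∀ l ∈ J, ((π l).castSucc : ℕ) < c l} =
        {π | ∀ j : Fin k, π (Fin.castLE hk j) ≤ i j} := by
      ext π
      simp only [Set.mem_ofPred_eq, Fin.val_castSucc, Fin.le_def]
      refine ⟨fun h j => ?_, fun h l hl => ?_⟩
      · have := h _ (mem_map.2 ⟨j, mem_univ j, rfl⟩)
        rw [Fin.coe_castLEEmb, hcj] at this
        omega
      · obtain ⟨j, -, rfl⟩ := mem_map.1 hl
        rw [Fin.coe_castLEEmb, hcj]
        have := h j
        omega
    rw [h2] at h1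
    simp only [h1, boxIndicator, prod_ite_zero, prod_const_one]
  obtain ⟨h1, h2⟩ := sum_boxIndicator_sub_bounds (ι := Fin n) (N := n + 1) (by simp) c hc J
  have hP : ∏ l ∈ J, ((c l : ℝ) / (n + 1 : ℕ)) =
      (∏ j : Fin k, (((i j : ℕ) : ℝ) + 1)) / ((n + 1 : ℕ) : ℝ) ^ k := by
    simp [J, prod_map, hcj, prod_div_distrib]
  rw [hP, Fintype.card_fin] at h1 h2
  rw [hJ] at h2
  rw [hlaw]
  set S : ℝ := ((n + 1 : ℕ) : ℝ) *
    ∑ u : Fin n → Fin (n + 1), parkingIndicator u * boxIndicator c J u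
  set N : ℝ := ((n + 1 : ℕ) : ℝ) with hN
  have hN0 : 0 < N := by positivity
  have hnN : (n : ℝ) ≤ N := by rw [hN]; push_cast; linarith
  set p : ℝ := ∏ j : Fin k, (((i j : ℕ) : ℝ) + 1)
  have hp0 : 0 ≤ p := by positivity
  have hpn : p ≤ (n : ℝ) ^ k := by
    calc p ≤ ∏ _j : Fin k, (n : ℝ) := prod_le_prod (fun _ _ => by positivity) fun j _ => by
          exact_mod_cast (i j).2
      _ = (n : ℝ) ^ k := by simp
  have h3 : |S / N ^ n - p / N ^ k| ≤ 24 * √((k : ℝ) / n) := by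
    have e : S / N ^ n - p / N ^ k = (S - p / N ^ k * N ^ n) / N ^ n := by field_simp
    rw [e, abs_of_nonneg (by positivity), div_le_iff₀ (by positivity)]
    refine h2.trans ?_
    have h4 : √(1 - p / N ^ k) ≤ 1 := by
      have : 0 ≤ p / N ^ k := by positivity
      exact Real.sqrt_le_one.2 (by linarith)
    calc 24 * N ^ n / √N * (√(k : ℝ) * √(1 - p / N ^ k))
        ≤ 24 * N ^ n / √(n : ℝ) * (√(k : ℝ) * 1) := by gcongr
      _ = 24 * √((k : ℝ) / n) * N ^ n := by
          rw [Real.sqrt_div (by positivity)]; ring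
  have h5 : |p / N ^ k - p / (n : ℝ) ^ k| ≤ √((k : ℝ) / n) := by
    have e : p / (n : ℝ) ^ k - p / N ^ k = p / (n : ℝ) ^ k * (1 - (n / N) ^ k) := by
      rw [div_pow]; field_simp
    have h6 : 0 ≤ 1 - ((n : ℝ) / N) ^ k :=
      sub_nonneg.2 (pow_le_one₀ (by positivity) ((div_le_one hN0).2 hnN))
    have h7 : p / (n : ℝ) ^ k ≤ 1 := (div_le_one (by positivity)).2 hpn
    rw [abs_sub_comm, e, abs_of_nonneg (by positivity)]
    calc _ ≤ 1 - ((n : ℝ) / N) ^ k := mul_le_of_le_one_left h6 h7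
      _ ≤ k / N := one_sub_div_pow_le k n
      _ ≤ (k : ℝ) / n := by gcongr
      _ ≤ √((k : ℝ) / n) := by
          refine Real.le_sqrt_of_sq_le ?_
          have : 0 ≤ (k : ℝ) / n := by positivity
          nlinarith
  have h8 := abs_sub_le (S / N ^ n) (p / N ^ k) (p / (n : ℝ) ^ k)
  linarith

theorem card_filter_castLE_eq {k n N : ℕ} (hk : k ≤ n) (a : Fin k → Fin N) :
    (#{u : Fin n → Fin N | ∀ j : Fin k, u (Fin.castLE hk j) = a j} : ℝ) * (N : ℝ) ^ k =
      (N : ℝ) ^ n := by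
  obtain ⟨m, rfl⟩ := Nat.exists_eq_add_of_le hk
  have h : #{u : Fin (k + m) → Fin N | ∀ j : Fin k, u (Fin.castLE hk j) = a j} = N ^ m := by
    rw [← Fintype.card_fin (N ^ m), ← Fintype.card_congr (finFunctionFinEquiv (m := N) (n := m)),
      ← card_univ]
    refine card_bij' (fun u _ l => u (Fin.natAdd k l)) (fun v _ => Fin.append a v) ?_ ?_ ?_ ?_
    · simp
    · intro v _
      simp only [mem_filter, mem_univ, true_and]
      intro j
      exact Fin.append_left a v j
    · intro u hu
      simp only [mem_filter, mem_univ, true_and] at hu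
      funext l
      refine Fin.addCases (fun j => ?_) (fun j => ?_) l
      · rw [Fin.append_left]; exact (hu j).symm
      · rw [Fin.append_right]
    · intro v _
      funext l
      simp
  rw [h]
  push_cast
  ring

theorem parkingDTV_le {k n : ℕ} (hk : k ≤ n) (hn : 1 ≤ n) :
    parkingDTV k n hk ≤ 17 * (k / √(n : ℝ)) := by
  have hn0 : (0 : ℝ) < n := by exact_mod_cast hn
  set N : ℝ := ((n + 1 : ℕ) : ℝ) with hN
  have hN0 : 0 < N := by positivity
  have hnN : (n : ℝ) ≤ N := by rw [hN]; push_cast; linarith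
  let I : (Fin k → Fin n) → (Fin n → Fin (n + 1)) → ℝ := fun i u =>
    if ∀ j : Fin k, u (Fin.castLE hk j) = (i j).castSucc then 1 else 0
  let p : (Fin k → Fin n) → ℝ := fun i =>
    N * (∑ u : Fin n → Fin (n + 1), parkingIndicator u * I i u) / N ^ n
  have hlaw : ∀ i : Fin k → Fin n,
      (parkingLaw n).real {π | ∀ j : Fin k, π (Fin.castLE hk j) = i j} = p i := by
    intro i
    have h1 := parkingLaw_real_eq (n := n) fun u =>
      ∀ j : Fin k, u (Fin.castLE hk j) = (i j).castSucc
    simpa only [Fin.castSucc_inj] using h1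
  let s : (Fin k → Fin n) → ℝ := fun i => SignType.sign (p i - 1 / N ^ k)
  have hsign : ∀ x : ℝ, |(SignType.sign x : ℝ)| ≤ 1 := fun x => by
    rcases lt_trichotomy x 0 with h | h | h <;> simp [h]
  have hs : ∀ i, |s i| ≤ 1 := fun i => hsign _
  let φ : (Fin n → Fin (n + 1)) → ℝ := fun u => ∑ i, s i * I i u
  have hI0 : ∀ i u, 0 ≤ I i u := fun i u => by simp only [I]; split_ifs <;> norm_num
  have hI : ∀ u, ∑ i, I i u ≤ 1 := by
    intro u
    simp only [I, sum_boole]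
    have : #{i : Fin k → Fin n | ∀ j : Fin k, u (Fin.castLE hk j) = (i j).castSucc} ≤ 1 := by
      refine card_le_one.2 fun i hi i' hi' => ?_
      simp only [mem_filter, mem_univ, true_and] at hi hi'
      funext j
      exact Fin.castSucc_injective _ ((hi j).symm.trans (hi' j))
    exact_mod_cast this
  have hφ1 : ∀ u, |φ u| ≤ 1 := by
    intro u
    refine (abs_sum_le_sum_abs _ _).trans (le_trans (sum_le_sum fun i _ => ?_) (hI u))
    rw [abs_mul, abs_of_nonneg (hI0 i u)]
    exact mul_le_of_le_one_left (hI0 i u) (hs i)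
  have hφ : ∀ u v, (∀ l ∈ univ.map (Fin.castLEEmb hk), u l = v l) → φ u = φ v := by
    intro u v huv
    have h1 : ∀ j : Fin k, u (Fin.castLE hk j) = v (Fin.castLE hk j) := fun j =>
      huv _ (mem_map.2 ⟨j, mem_univ j, rfl⟩)
    simp only [φ, I, h1]
  have hmain := abs_sum_parkingIndicator_mul_sub_le (ι := Fin n) (N := n + 1) (by simp) _ φ hφ1 hφ
  rw [card_map, card_univ, Fintype.card_fin, Fintype.card_fin, ← hN] at hmain
  have hA : N * ∑ u, parkingIndicator u * φ u = N ^ n * ∑ i, s i * p i := by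
    simp only [φ, p, mul_sum]
    rw [sum_comm]
    refine sum_congr rfl fun i _ => ?_
    rw [← mul_sum, ← mul_sum, mul_div_assoc', mul_div_assoc',
      mul_div_cancel_left₀ _ (by positivity), mul_sum, mul_sum, mul_sum]
    exact sum_congr rfl fun u _ => by ring
  have hB : ∑ u, φ u = N ^ n * ∑ i, s i * (1 / N ^ k) := by
    simp only [φ]
    rw [sum_comm, mul_sum]
    refine sum_congr rfl fun i _ => ?_
    rw [← mul_sum]
    have h1 := card_filter_castLE_eq hk fun j => (i j).castSucc
    simp only [I, sum_boole]
    rw [← hN] at h1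
    rw [← h1]
    field_simp
  have h1 : ∑ i, |p i - 1 / N ^ k| ≤ 16 * (k / √(n : ℝ)) := by
    have e : N ^ n * ∑ i, |p i - 1 / N ^ k| =
        N * ∑ u, parkingIndicator u * φ u - ∑ u, φ u := by
      rw [hA, hB, ← mul_sub, ← sum_sub_distrib]
      congr 1
      refine sum_congr rfl fun i _ => ?_
      rw [← mul_sub, ← sign_mul_self]
    have h2 : N * (N ^ n * ∑ i, |p i - 1 / N ^ k|) ≤ k * (16 * N ^ n * √N) := by
      rw [e]
      refine le_trans ?_ hmain
      gcongr
      exact le_abs_self _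
    have h3 : N ^ n * √N * (√N * ∑ i, |p i - 1 / N ^ k|) ≤ N ^ n * √N * (16 * k) := by
      have := Real.mul_self_sqrt hN0.le
      calc _ = (√N * √N) * (N ^ n * ∑ i, |p i - 1 / N ^ k|) := by ring
        _ ≤ k * (16 * N ^ n * √N) := by rwa [this]
        _ = _ := by ring
    have h4 := le_of_mul_le_mul_left h3 (by positivity)
    have h5 : √(n : ℝ) ≤ √N := Real.sqrt_le_sqrt hnN
    rw [← mul_div_assoc, le_div_iff₀ (by positivity), mul_comm]
    refine le_trans ?_ h4
    gcongr
  have h2 : ∑ _i : Fin k → Fin n, |1 / N ^ k - 1 / (n : ℝ) ^ k| ≤ k / √(n : ℝ) := by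
    have h6 : 1 / N ^ k ≤ 1 / (n : ℝ) ^ k := by gcongr
    rw [sum_const, card_univ, abs_sub_comm, abs_of_nonneg (sub_nonneg.2 h6), nsmul_eq_mul,
      Fintype.card_fun, Fintype.card_fin, Fintype.card_fin]
    push_cast
    calc (n : ℝ) ^ k * (1 / (n : ℝ) ^ k - 1 / N ^ k) = 1 - (n / N) ^ k := by
          rw [div_pow]; field_simp
      _ ≤ k / N := one_sub_div_pow_le k n
      _ ≤ k / √(n : ℝ) := by
          gcongr
          rw [Real.sqrt_le_iff]
          have : (1 : ℝ) ≤ n := by exact_mod_cast hn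
          exact ⟨hN0.le, by nlinarith⟩
  calc parkingDTV k n hk = ∑ i, |p i - 1 / (n : ℝ) ^ k| := by
        simp only [parkingDTV, hlaw]
    _ ≤ ∑ i, (|p i - 1 / N ^ k| + |1 / N ^ k - 1 / (n : ℝ) ^ k|) :=
        sum_le_sum fun i _ => abs_sub_le _ _ _
    _ ≤ 17 * (k / √(n : ℝ)) := by
        rw [sum_add_distrib]; linarith

end ParkingLaw

theorem theorem1 (k : ℕ → ℕ) (hk : ∀ n, k n ≤ n) :
    ((fun n : ℕ => (k n : ℝ)) =o[atTop] (fun n : ℕ => √(n : ℝ)) →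
      (fun n : ℕ => parkingDTV (k n) n (hk n)) =O[atTop]
        (fun n : ℕ => (k n : ℝ) / √(n : ℝ))) ∧
    ((fun n : ℕ => (k n : ℝ)) =o[atTop] (fun n : ℕ => (n : ℝ)) →
      (fun n : ℕ => √(n : ℝ)) =o[atTop] (fun n : ℕ => (k n : ℝ)) →
      (fun n : ℕ => parkingDK (k n) n (hk n)) =O[atTop]
        (fun n : ℕ => √(n : ℝ) / (k n : ℝ) + ((k n : ℝ) / (n : ℝ)) ^ (0.19 : ℝ))) := by
  refine ⟨fun _ => IsBigO.of_bound 17 ?_, fun _ _ => IsBigO.of_bound 25 ?_⟩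
  · filter_upwards [eventually_ge_atTop 1] with n hn
    have h0 : 0 ≤ parkingDTV (k n) n (hk n) := Finset.sum_nonneg fun _ _ => abs_nonneg _
    rw [Real.norm_of_nonneg h0, Real.norm_of_nonneg (by positivity)]
    exact parkingDTV_le (hk n) hn
  · filter_upwards [eventually_ge_atTop 1] with n hn
    have h0 : 0 ≤ parkingDK (k n) n (hk n) := Real.iSup_nonneg fun _ => abs_nonneg _
    have hn0 : (0 : ℝ) < n := by exact_mod_cast hn
    have hkn : (k n : ℝ) / n ≤ 1 := by
      rw [div_le_one hn0]; exact_mod_cast hk n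
    rw [Real.norm_of_nonneg h0, Real.norm_of_nonneg (by positivity)]
    have h1 := parkingDK_le (hk n) hn
    have h2 : √((k n : ℝ) / n) ≤ ((k n : ℝ) / n) ^ (0.19 : ℝ) := by
      rw [Real.sqrt_eq_rpow]
      exact Real.rpow_le_rpow_of_exponent_ge' (by positivity) hkn (by norm_num) (by norm_num)
    have h3 : 0 ≤ √(n : ℝ) / (k n : ℝ) := by positivity
    linarith
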